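/- Let $X$ be a path-connected, locally finite CW complex, $P:\widetilde X\to X$ its universal covering, and let $\pi=\pi_1(X)$ (with base point $P(\tilde x_0)$ for some $\tilde x_0\in\widetilde X$) act on $\widetilde X$ by deck transformations. Then for every integer $n\ge 2$, $$\widetilde{\operatorname{TC}}_n(X)=\operatorname{TC}^*_{\pi,n}(\widetilde X)\in\{1,2,3,\dots\}\cup\{\infty\}.$$ Here the two invariants are defined as follows; a minimum over the empty set is $\infty$. (1) Let $\prod_\pi\widetilde X=\widetilde X^n/\pi$ be the quotient by the diagonal action, let $$E=\Bigl\{(\omega,x_1,\dots,x_n)\;:\;\omega\in\widetilde X^{[0,1]},\ x_j\in\widetilde X,\ \omega\bigl(\tfrac{j-1}{n-1}\bigr)=x_j\ (1\le j\le n)\Bigr\}\Big/\pi$$ (compact-open topology on paths and quotient topology; $E$ is identified with $X^{[0,1]}$ by lifting paths), and let $p:E\to\prod_\pi\widetilde X$, $q:\prod_\pi\widetilde X\to X^n$ be the maps $p[\omega,x_1,\dots,x_n]=[x_1,\dots,x_n]$ and $q[x_1,\dots,x_n]=(Px_1,\dots,Px_n)$. Then $\widetilde{\operatorname{TC}}_n(X)$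 is the least integer $k\ge1$ such that $X^n$ has an open cover $U_1,\dots,U_k$ for which $p$ admits a continuous section over each $q^{-1}(U_i)$. (2) Let $I_n$ be the wedge of $n$ copies $[0,1]_1,\dots,[0,1]_n$ of the unit interval, glued at their points $0$, and let $1_j\in I_n$ be the endpoint $1$ of $[0,1]_j$. For a space $Y$ with an action of a discrete group $G$, $\operatorname{TC}^*_{G,n}(Y)$ is the least integer $k\ge1$ such that $Y^n$ has a cover by $k$ open sets $U_1,\dots,U_k$, each invariant under the product action of $G^n$, such that over each $U_i$ the map $e_n:Y^{I_n}\to Y^n$, $e_n(\alpha)=(\alpha(1_1),\dots,\alpha(1_n))$, has a continuous section $U_i\to Y^{I_n}$ that is equivariant for the diagonal action of $G$. -/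

import Mathlib

open Set Topology unitInterval

/-! ### CW complexes -/

/-- A CW complex structure on the whole space `X` is locally finite if every point of `X` has a
neighbourhood which meets only finitely many closed cells. -/
def IsLocallyFiniteCW (X : Type*) [TopologicalSpace X] [CWComplex (univ : Set X)] : Prop :=
  LocallyFinite fun c : Σ n, RelCWComplex.cell (univ : Set X) n =>
    RelCWComplex.closedCell (C := (univ : Set X)) c.1 c.2

/-- The closed unit ball of `ℝⁿ` is a retract of `ℝⁿ`, hence locally path-connected. -/
theorem locallyPathConnected_closedBall (n : ℕ) :
    LocallyPathConnectedSpace (Metric.closedBall (0 : Fin n → ℝ) 1) := by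
  have hmem : ∀ x : Fin n → ℝ,
      (fun j => max (-1) (min 1 (x j))) ∈ Metric.closedBall (0 : Fin n → ℝ) 1 := by
    intro x
    rw [mem_closedBall_zero_iff, pi_norm_le_iff_of_nonneg zero_le_one]
    intro j
    rw [Real.norm_eq_abs, abs_le]
    exact ⟨le_max_left _ _, max_le (by norm_num) (min_le_left _ _)⟩
  let r : (Fin n → ℝ) → Metric.closedBall (0 : Fin n → ℝ) 1 := fun x => ⟨_, hmem x⟩
  have hr : Continuous r := by
    refine Continuous.subtype_mk (continuous_pi fun j => ?_) _
    fun_prop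
  have hq : IsQuotientMap r := by
    refine IsQuotientMap.of_inverse (f := Subtype.val) continuous_subtype_val hr ?_
    rintro ⟨x, hx⟩
    refine Subtype.ext (funext fun j => ?_)
    rw [mem_closedBall_zero_iff, pi_norm_le_iff_of_nonneg zero_le_one] at hx
    have h := abs_le.1 (Real.norm_eq_abs (x j) ▸ hx j)
    change max (-1) (min 1 (x j)) = x j
    rw [min_eq_right h.2, max_eq_right h.1]
  exact hq.locallyPathConnectedSpace

/-- CW complexes are locally path-connected, being quotients of disjoint unions of balls. -/
instance locallyPathConnectedSpace_of_cwComplex {X : Type*} [TopologicalSpace X] [T2Space X]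
    [CWComplex (univ : Set X)] : LocallyPathConnectedSpace X := by
  let J := Σ n, RelCWComplex.cell (univ : Set X) n
  have hball : ∀ c : J, LocallyPathConnectedSpace (Metric.closedBall (0 : Fin c.1 → ℝ) 1) :=
    fun c => locallyPathConnected_closedBall c.1
  let f : (Σ c : J, Metric.closedBall (0 : Fin c.1 → ℝ) 1) → X :=
    fun y => RelCWComplex.map y.1.1 y.1.2 y.2.1
  have hc : ∀ c : J, Continuous fun z : Metric.closedBall (0 : Fin c.1 → ℝ) 1 => f ⟨c, z⟩ :=
    fun c => (RelCWComplex.continuousOn c.1 c.2).domRestrict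
  have hf : Continuous f := continuous_sigma hc
  have hq : IsQuotientMap f := by
    refine isQuotientMap_iff_isClosed.2 ⟨?_, fun A => ⟨fun h => h.preimage hf, fun h => ?_⟩⟩
    · intro x
      have hx : x ∈ ⋃ (n : ℕ) (j : RelCWComplex.cell (univ : Set X) n),
          RelCWComplex.closedCell (C := (univ : Set X)) n j := by
        rw [CWComplex.union]; trivial
      simp only [mem_iUnion] at hx
      obtain ⟨n, j, z, hz, rfl⟩ := hx
      exact ⟨⟨⟨n, j⟩, ⟨z, hz⟩⟩, rfl⟩
    · refine CWComplex.closed' A (subset_univ _) fun n j => ?_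
      have h1 : IsClosed ((fun z : Metric.closedBall (0 : Fin n → ℝ) 1 =>
          f ⟨⟨n, j⟩, z⟩) ⁻¹' A) := isClosed_sigma_iff.1 h ⟨n, j⟩
      have h2 := (h1.isCompact.image (hc ⟨n, j⟩)).isClosed
      convert h2 using 1
      ext x
      constructor
      · rintro ⟨hx, z, hz, rfl⟩
        exact ⟨⟨z, hz⟩, hx, rfl⟩
      · rintro ⟨⟨z, hz⟩, hx, rfl⟩
        exact ⟨hx, z, hz, rfl⟩
  exact hq.locallyPathConnectedSpace

/-! ### Deck transformations and the action of the fundamental group on the universal cover -/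

section Deck

variable {X E : Type*} [TopologicalSpace X] [TopologicalSpace E]

/-- The deck transformations of `P : E → X`: the self-homeomorphisms of `E` over `X`. -/
def deckGroup (P : E → X) : Subgroup (E ≃ₜ E) where
  carrier := {φ | ∀ e, P (φ e) = P e}
  mul_mem' {φ ψ} hφ hψ e := (hφ (ψ e)).trans (hψ e)
  one_mem' _ := rfl
  inv_mem' {φ} hφ e := by
    have h := hφ (φ.symm e)
    rw [φ.apply_symm_apply] at h
    exact h.symm

instance deckMulAction (P : E → X) : MulAction (deckGroup P) E where
  smul φ e := φ.1 e
  one_smul _ := rfl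
  mul_smul _ _ _ := rfl

theorem IsCoveringMap.surjective_of_pathConnected [PathConnectedSpace X] [Nonempty E] {P : E → X}
    (hP : IsCoveringMap P) : Function.Surjective P := by
  intro x
  obtain ⟨e⟩ := ‹Nonempty E›
  let γ := PathConnectedSpace.somePath (P e) x
  refine ⟨hP.liftPath γ e γ.source 1, ?_⟩
  have h := congrFun (hP.liftPath_lifts γ e γ.source) 1
  exact h.trans γ.target

theorem IsCoveringMap.locallyPathConnected_total [LocallyPathConnectedSpace X] {P : E → X}
    (hP : IsCoveringMap P) : LocallyPathConnectedSpace E := by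
  choose c hc _ using hP.isLocalHomeomorph
  let _ : ChartedSpace X E :=
    { atlas := range c
      chartAt := c
      mem_chart_source := hc
      chart_mem_atlas := mem_range_self }
  exact ChartedSpace.locallyPathConnectedSpace X E

theorem IsCoveringMap.exists_deck [LocallyPathConnectedSpace X] [SimplyConnectedSpace E] {P : E → X}
    (hP : IsCoveringMap P) {e e' : E} (h : P e = P e') : ∃ φ : deckGroup P, φ • e' = e := by
  have := hP.locallyPathConnected_total
  let f : C(E, X) := ⟨P, hP.continuous⟩
  obtain ⟨F, ⟨hF, hF'⟩, -⟩ := hP.existsUnique_continuousMap_lifts f e' e h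
  obtain ⟨G, ⟨hG, hG'⟩, -⟩ := hP.existsUnique_continuousMap_lifts f e e' h.symm
  have hFp : ∀ a, P (F a) = P a := congrFun hF'
  have hGp : ∀ a, P (G a) = P a := congrFun hG'
  have h1 : G ∘ F = id := hP.eq_of_comp_eq (G.continuous.comp F.continuous) continuous_id
    (by ext a; simp [hFp, hGp]) e' (by simp [hF, hG])
  have h2 : F ∘ G = id := hP.eq_of_comp_eq (F.continuous.comp G.continuous) continuous_id
    (by ext a; simp [hFp, hGp]) e (by simp [hF, hG])
  exact ⟨⟨⟨⟨F, G, congrFun h1, congrFun h2⟩, F.continuous, G.continuous⟩, hFp⟩, hF⟩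

theorem IsCoveringMap.isQuotientCoveringMap_deck [PathConnectedSpace X]
    [LocallyPathConnectedSpace X] [SimplyConnectedSpace E] {P : E → X} (hP : IsCoveringMap P) :
    IsQuotientCoveringMap P (deckGroup P) where
  toIsQuotientMap := hP.isQuotientMap hP.surjective_of_pathConnected
  continuous_const_smul φ := φ.1.continuous
  apply_eq_iff_mem_orbit {e e'} := by
    constructor
    · exact fun h => hP.exists_deck h
    · rintro ⟨φ, rfl⟩
      exact φ.2 e'
  disjoint e := by
    obtain ⟨U, hU, he, hinj⟩ := hP.isLocalHomeomorph.isLocallyInjective e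
    refine ⟨U, hU.mem_nhds he, ?_⟩
    rintro φ ⟨_, ⟨y, hy, rfl⟩, hy'⟩
    have hfix : φ.1 y = y := hinj hy' hy (φ.2 y)
    have : (φ.1 : E → E) = id := hP.eq_of_comp_eq φ.1.continuous continuous_id
      (funext φ.2) y hfix
    exact Subtype.ext (Homeomorph.ext (congrFun this))

/-- The fundamental group `π₁(X, x)`, with the usual product `[γ] [δ] = [γ followed by δ]`.
Mathlib's `FundamentalGroup X x` carries the opposite product. -/
abbrev PiOne (X : Type*) [TopologicalSpace X] (x : X) : Type _ := (FundamentalGroup X x)ᵐᵒᵖ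

/-- The action of `π₁(X, P e₀)` on the total space of a universal covering `P : E → X` by deck
transformations: the class of a loop `γ` acts by the unique deck transformation which takes `e₀` to
the endpoint of the lift of `γ` that starts at `e₀`. -/
noncomputable def deckAction [PathConnectedSpace X] [LocallyPathConnectedSpace X]
    [SimplyConnectedSpace E] {P : E → X} (hP : IsCoveringMap P) (e₀ : E) :
    PiOne X (P e₀) →* (E ≃ₜ E) :=
  (deckGroup P).subtype.comp <| MonoidHom.comp (MulEquiv.opOp (deckGroup P)).symm.toMonoidHom <|
    (MulEquiv.op (hP.isQuotientCoveringMap_deck.fundamentalGroupEquiv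
      (⟨e₀, rfl⟩ : P ⁻¹' {P e₀}))).toMonoidHom

theorem apply_deckAction [PathConnectedSpace X] [LocallyPathConnectedSpace X]
    [SimplyConnectedSpace E] {P : E → X} (hP : IsCoveringMap P) (e₀ : E) (γ : PiOne X (P e₀))
    (e : E) : P (deckAction hP e₀ γ e) = P e :=
  Subtype.property (p := fun φ => φ ∈ deckGroup P) _ e

theorem deckAction_basepoint [PathConnectedSpace X] [LocallyPathConnectedSpace X]
    [SimplyConnectedSpace E] {P : E → X} (hP : IsCoveringMap P) (e₀ : E)
    (γ : FundamentalGroup X (P e₀)) :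
    deckAction hP e₀ (MulOpposite.op γ) e₀ = hP.monodromy γ ⟨e₀, rfl⟩ :=
  hP.isQuotientCoveringMap_deck.unop_fundamentalGroupToMulOpposite_smul
    (e := (⟨e₀, rfl⟩ : P ⁻¹' {P e₀}))

end Deck

/-! ### Sectional categories -/

/-- The least integer `k ≥ 1` with the property `Q`, and `∞` if there is none. -/
noncomputable def leastCount (Q : ℕ → Prop) : ℕ∞ :=
  sInf ((fun k : ℕ => (k : ℕ∞)) '' {k | 1 ≤ k ∧ Q k})

/-- For maps `p : A → B` and `q : B → C`, the least `k ≥ 1` such that `C` is covered by `k` open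
sets `U` for which `p` has a continuous section over `q ⁻¹' U`. -/
noncomputable def secatTilde {A B C : Type*} [TopologicalSpace A] [TopologicalSpace B]
    [TopologicalSpace C] (p : A → B) (q : B → C) : ℕ∞ :=
  leastCount fun k => ∃ U : Fin k → Set C, (∀ i, IsOpen (U i)) ∧ (⋃ i, U i) = univ ∧
    ∀ i, ∃ s : C(q ⁻¹' U i, A), ∀ b, p (s b) = b

/-! ### Strongly equivariant topological complexity -/

/-- The wedge of `n` copies of `[0, 1]`, glued at their points `0`. -/
def wedgeSetoid (n : ℕ) : Setoid (Fin n × I) where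
  r a b := a = b ∨ (a.2 = 0 ∧ b.2 = 0)
  iseqv := ⟨fun _ => Or.inl rfl, fun h => h.imp Eq.symm And.symm, by
    rintro a b c (rfl | h) (rfl | h')
    · exact Or.inl rfl
    · exact Or.inr h'
    · exact Or.inr h
    · exact Or.inr ⟨h.1, h'.2⟩⟩

/-- The wedge `I_n` of `n` intervals, with the quotient topology. -/
abbrev WedgeI (n : ℕ) : Type := Quotient (wedgeSetoid n)

/-- The endpoint `1` of the `j`-th interval of `I_n`. -/
def wedgeEnd {n : ℕ} (j : Fin n) : WedgeI n := Quotient.mk (wedgeSetoid n) (j, 1)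

/-- The `n`-th strongly equivariant topological complexity of a space `Y` with an action
`ρ` of the discrete group `G`: the least number of open sets `U` that are invariant under `G ^ n`,
cover `Y ^ n`, and have a continuous section of the evaluation map `Y ^ (I_n) → Y ^ n` at the ends
of the intervals which is equivariant for the diagonal action of `G`. -/
noncomputable def strongTC {G Y : Type*} [Group G] [TopologicalSpace Y] (n : ℕ)
    (ρ : G →* (Y ≃ₜ Y)) : ℕ∞ :=
  leastCount fun k => ∃ U : Fin k → Set (Fin n → Y), (∀ i, IsOpen (U i)) ∧ (⋃ i, U i) = univ ∧
    (∀ i, ∀ g : Fin n → G, ∀ x ∈ U i, (fun j => ρ (g j) (x j)) ∈ U i) ∧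
    ∀ i, ∃ s : C(U i, C(WedgeI n, Y)), (∀ x j, s x (wedgeEnd j) = x.1 j) ∧
      ∀ (g : G) (x y : U i), (∀ j, y.1 j = ρ g (x.1 j)) → ∀ t, s y t = ρ g (s x t)

/-! ### The intermediate invariant -/

section Intermediate

variable {G E X : Type*} [Group G] [TopologicalSpace E] [TopologicalSpace X]

/-- The point `j / (n - 1)` of `[0, 1]`, for `j = 0, …, n - 1`. -/
noncomputable def subdiv (n : ℕ) (j : Fin n) : I :=
  ⟨(j : ℝ) / ((n : ℝ) - 1), by
    have h : ((j : ℕ) : ℝ) + 1 ≤ n := by exact_mod_cast j.2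
    have h0 : (0 : ℝ) ≤ (j : ℕ) := Nat.cast_nonneg _
    exact ⟨div_nonneg h0 (by linarith), div_le_one_of_le₀ (by linarith) (by linarith)⟩⟩

/-- The tuples `(ω, x₁, …, xₙ)` of a path `ω` in `E` and its points at the times `j / (n - 1)`. -/
abbrev PathTuple (n : ℕ) (E : Type*) [TopologicalSpace E] : Type _ :=
  {a : C(I, E) × (Fin n → E) // ∀ j, a.1 (subdiv n j) = a.2 j}

/-- The orbit relation of the diagonal action of `G` on `E ^ n`. -/
def tupleSetoid (n : ℕ) (ρ : G →* (E ≃ₜ E)) : Setoid (Fin n → E) where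
  r x y := ∃ g, ∀ j, y j = ρ g (x j)
  iseqv := ⟨fun _ => ⟨1, by simp⟩, fun {x y} ⟨g, h⟩ => ⟨g⁻¹, fun j => by
      rw [h j, ← Homeomorph.mul_apply, ← map_mul, inv_mul_cancel, map_one, Homeomorph.one_apply]⟩,
    fun {x y z} ⟨g, h⟩ ⟨g', h'⟩ => ⟨g' * g, fun j => by
      rw [h' j, h j, map_mul, Homeomorph.mul_apply]⟩⟩

/-- The orbit relation of the action of `G` on tuples `(ω, x₁, …, xₙ)`. -/
def pathTupleSetoid (n : ℕ) (ρ : G →* (E ≃ₜ E)) : Setoid (PathTuple n E) where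
  r a b := ∃ g, (∀ t, b.1.1 t = ρ g (a.1.1 t)) ∧ ∀ j, b.1.2 j = ρ g (a.1.2 j)
  iseqv := ⟨fun _ => ⟨1, by simp⟩, fun {a b} ⟨g, h, k⟩ => ⟨g⁻¹, fun t => by
      rw [h t, ← Homeomorph.mul_apply, ← map_mul, inv_mul_cancel, map_one, Homeomorph.one_apply],
      fun j => by
      rw [k j, ← Homeomorph.mul_apply, ← map_mul, inv_mul_cancel, map_one, Homeomorph.one_apply]⟩,
    fun {a b c} ⟨g, h, k⟩ ⟨g', h', k'⟩ => ⟨g' * g, fun t => by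
      rw [h' t, h t, map_mul, Homeomorph.mul_apply], fun j => by
      rw [k' j, k j, map_mul, Homeomorph.mul_apply]⟩⟩

/-- `p [ω, x₁, …, xₙ] = [x₁, …, xₙ]`. -/
def evalMap (n : ℕ) (ρ : G →* (E ≃ₜ E)) :
    Quotient (pathTupleSetoid n ρ) → Quotient (tupleSetoid n ρ) :=
  Quotient.map' (fun a => a.1.2) fun _ _ ⟨g, _, k⟩ => ⟨g, k⟩

/-- `q [x₁, …, xₙ] = (P x₁, …, P xₙ)`, for a map `P` that is constant on orbits. -/
def projMap (n : ℕ) (ρ : G →* (E ≃ₜ E)) (P : E → X) (h : ∀ g e, P (ρ g e) = P e) :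
    Quotient (tupleSetoid n ρ) → (Fin n → X) :=
  Quotient.lift (fun x j => P (x j)) fun x y ⟨g, k⟩ => funext fun j => by rw [k j, h]

/-- The invariant `TC̃_n(X)` of a space `X` with universal covering `P : E → X`. -/
noncomputable def tildeTC [PathConnectedSpace X] [LocallyPathConnectedSpace X]
    [SimplyConnectedSpace E] {P : E → X} (n : ℕ) (hP : IsCoveringMap P) (e₀ : E) : ℕ∞ :=
  secatTilde (evalMap n (deckAction hP e₀))
    (projMap n (deckAction hP e₀) P (apply_deckAction hP e₀))

end Intermediate

/-!
Both invariants ask for equivariant families of maps into `E` with prescribed values at `n` marked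
points: `[0, 1]` marked at the times `j / (n - 1)` for `TC̃_n`, the wedge `I_n` marked at its ends
for `TC*`. Each of these spaces maps to the other with marked points going to marked points, so by
precomposition it does not matter which one is used.

For `TC̃_n` the family appears as a section of `p` on orbit spaces. As `π` acts properly
discontinuously, the space of tuples `(ω, x₁, …, xₙ)` is the pullback of `p` along
`E ^ n → E ^ n / π`, so such a section is the same as an equivariant one upstairs. Finally, the open
`π ^ n`-invariant sets in `E ^ n` are exactly the preimages of the open sets in `X ^ n`.
-/

section Topology

variable {A B Q : Type*} [TopologicalSpace A] [TopologicalSpace B] [TopologicalSpace Q]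

theorem isEmbedding_prodMk_of_injOn_preimage {f : A → B} {π : A → Q} (hf : Continuous f)
    (hπ : Continuous π) (hπo : IsOpenMap π) (hinj : ∀ b, ∃ N ∈ 𝓝 b, InjOn π (f ⁻¹' N)) :
    IsEmbedding fun a => (f a, π a) := by
  refine ⟨isInducing_iff_nhds.2 fun a => le_antisymm (hf.prodMk hπ).continuousAt.le_comap ?_, ?_⟩
  · intro W hW
    obtain ⟨N, hN, hinjN⟩ := hinj (f a)
    have hWN : W ∩ f ⁻¹' N ∈ 𝓝 a := Filter.inter_mem hW (hf.continuousAt.preimage_mem_nhds hN)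
    refine ⟨N ×ˢ (π '' (W ∩ f ⁻¹' N)), prod_mem_nhds hN (hπo.image_mem_nhds hWN), ?_⟩
    rintro a' ⟨ha', w, ⟨hwW, hwN⟩, hw⟩
    rwa [← hinjN hwN ha' hw]
  · intro a a' h
    obtain ⟨hf', hπ'⟩ := Prod.mk.inj h
    obtain ⟨N, hN, hinjN⟩ := hinj (f a)
    have ha : f a ∈ N := mem_of_mem_nhds hN
    have ha' : f a' ∈ N := hf' ▸ ha
    exact hinjN ha ha' hπ'

theorem isOpenQuotientMap_of_apply_eq_iff {G : Type*} {f : A → Q} (hf : IsQuotientMap f)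
    {T : G → A → A} (hT : ∀ g, Continuous (T g)) (h : ∀ a b, f a = f b ↔ ∃ g, T g a = b) :
    IsOpenQuotientMap f := by
  refine .of_isOpenMap_isQuotientMap (fun W hW => hf.isOpen_preimage.1 ?_) hf
  have hsat : f ⁻¹' (f '' W) = ⋃ g, T g ⁻¹' W := by
    ext b
    simp only [mem_preimage, mem_image, mem_iUnion]
    constructor
    · rintro ⟨a, ha, hab⟩
      obtain ⟨g, rfl⟩ := (h b a).1 hab.symm
      exact ⟨g, ha⟩
    · rintro ⟨g, hg⟩
      exact ⟨_, hg, ((h b _).2 ⟨g, rfl⟩).symm⟩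
  rw [hsat]
  exact isOpen_iUnion fun g => hW.preimage (hT g)

end Topology

/-! ### Maps between a marked space and the wedge -/

section Wedge

variable {K : Type*} [TopologicalSpace K] {n : ℕ}

theorem exists_continuousMap_wedge_apply_wedgeEnd_eq [PathConnectedSpace K] (c : Fin n → K) :
    ∃ r : C(WedgeI n, K), ∀ j, r (wedgeEnd j) = c j := by
  obtain ⟨b⟩ := PathConnectedSpace.nonempty (X := K)
  let γ := fun j => PathConnectedSpace.somePath b (c j)
  refine ⟨⟨Quotient.lift (fun a : Fin n × I => γ a.1 a.2) ?_, ?_⟩, fun j => (γ j).target⟩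
  · rintro a a' (rfl | ⟨h, h'⟩)
    · rfl
    · rw [h, h', (γ a.1).source, (γ a'.1).source]
  · exact (continuous_prod_of_discrete_left.2 fun j => (γ j).continuous).quotient_lift _

theorem exists_continuousMap_apply_eq_one_of_injective [T35Space K] {ι : Type*} [Finite ι]
    {c : ι → K} (hc : Function.Injective c) :
    ∃ f : ι → C(K, I), (∀ j, f j (c j) = 1) ∧ ∀ u i j, i ≠ j → f i u = 0 ∨ f j u = 0 := by
  obtain ⟨U, hU, hdisj⟩ := (finite_range c).t2_separation
  choose f hf hf0 hf1 using fun j => CompletelyRegularSpace.completely_regular (c j) (U (c j))ᶜ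
    (hU _).2.isClosed_compl (not_not.2 (hU _).1)
  refine ⟨fun j => ⟨fun u => σ (f j u), continuous_symm.comp (hf j)⟩, fun j => ?_,
    fun u i j hij => ?_⟩
  · simp only [ContinuousMap.coe_mk, hf0, symm_zero]
  · have hUij := hdisj (mem_range_self i) (mem_range_self j) (hc.ne hij)
    by_cases hu : u ∈ U (c i)
    · exact Or.inr (by simp [hf1 j (disjoint_left.1 hUij hu)])
    · exact Or.inl (by simp [hf1 i hu])

theorem exists_continuousMap_wedge_of_disjoint_support [NeZero n] (f : Fin n → C(K, I))
    (hf : ∀ u i j, i ≠ j → f i u = 0 ∨ f j u = 0) :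
    ∃ r : C(K, WedgeI n), ∀ j u, f j u ≠ 0 → r u = Quotient.mk (wedgeSetoid n) (j, f j u) := by
  let A : Fin n → Set K := fun j => {u | ∀ i, i ≠ j → f i u = 0}
  have hA : ∀ j, IsClosed (A j) := fun j => by
    simp only [A, ofPred_forall]
    exact isClosed_iInter fun i => isClosed_iInter fun _ =>
      isClosed_eq (f i).continuous continuous_const
  have hmemA : ∀ {j u}, f j u ≠ 0 → u ∈ A j := fun hj i hij => (hf _ i _ hij).resolve_right hj
  have hcover : ∀ u, ∃ j, u ∈ A j := fun u => by
    by_cases h : ∃ j, f j u ≠ 0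
    · exact h.imp fun _ => hmemA
    · exact ⟨0, fun i _ => not_not.1 (not_exists.1 h i)⟩
  choose k hk using hcover
  let r : K → WedgeI n := fun u => Quotient.mk (wedgeSetoid n) (k u, f (k u) u)
  have hr : ∀ j, ∀ u ∈ A j, r u = Quotient.mk (wedgeSetoid n) (j, f j u) := by
    intro j u hu
    by_cases hj : k u = j
    · simp only [r, hj]
    · exact Quotient.sound (Or.inr ⟨hu _ hj, hk u _ (Ne.symm hj)⟩)
  refine ⟨⟨r, (locallyFinite_of_finite A).continuous ?_ hA fun j => ?_⟩,
    fun j u hj => hr j u (hmemA hj)⟩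
  · exact eq_univ_of_forall fun u => mem_iUnion.2 ⟨k u, hk u⟩
  · refine ContinuousOn.congr (Continuous.continuousOn ?_) (hr j)
    exact continuous_quotient_mk'.comp (continuous_const.prodMk (f j).continuous)

theorem exists_continuousMap_apply_eq_wedgeEnd [T35Space K] [NeZero n] {c : Fin n → K}
    (hc : Function.Injective c) : ∃ r : C(K, WedgeI n), ∀ j, r (c j) = wedgeEnd j := by
  obtain ⟨f, hf1, hf⟩ := exists_continuousMap_apply_eq_one_of_injective hc
  obtain ⟨r, hr⟩ := exists_continuousMap_wedge_of_disjoint_support f hf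
  refine ⟨r, fun j => ?_⟩
  rw [hr j (c j) (by rw [hf1]; exact one_ne_zero), hf1]
  rfl

theorem subdiv_injective (hn : 2 ≤ n) : Function.Injective (subdiv n) := by
  intro i j h
  have hn' : (n : ℝ) - 1 ≠ 0 := by
    have : (2 : ℝ) ≤ n := by exact_mod_cast hn
    linarith
  have hij : (i : ℝ) = j := (div_left_inj' hn').1 (congrArg Subtype.val h)
  exact Fin.ext (by exact_mod_cast hij)

end Wedge

/-! ### Equivariant sections of evaluation maps -/

section EquivariantSection

variable {G E K L ι : Type*} [Group G] [TopologicalSpace E] [TopologicalSpace K]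
  [TopologicalSpace L] {ρ : G →* (E ≃ₜ E)}

/-- Over `V ⊆ E ^ ι`, the evaluation `E ^ K → E ^ ι` at the marked points `c` has a continuous
section that is equivariant for the diagonal action of `G`. As `V` need not be invariant,
equivariance concerns only pairs of points of `V` in the same orbit. -/
def HasEquivariantSection (ρ : G →* (E ≃ₜ E)) (c : ι → K) (V : Set (ι → E)) : Prop :=
  ∃ s : C(V, C(K, E)), (∀ x j, s x (c j) = x.1 j) ∧
    ∀ (g : G) (x y : V), (∀ j, y.1 j = ρ g (x.1 j)) → ∀ t, s y t = ρ g (s x t)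

theorem HasEquivariantSection.of_continuousMap {c : ι → K} {d : ι → L} {V : Set (ι → E)}
    (hV : HasEquivariantSection ρ c V) (r : C(L, K)) (hr : ∀ j, r (d j) = c j) :
    HasEquivariantSection ρ d V := by
  obtain ⟨s, hs, heq⟩ := hV
  refine ⟨⟨fun x => (s x).comp r, (ContinuousMap.continuous_precomp r).comp s.continuous⟩,
    fun x j => ?_, fun g x y hxy t => heq g x y hxy (r t)⟩
  exact (congrArg (s x) (hr j)).trans (hs x j)

theorem hasEquivariantSection_wedgeEnd_iff [T35Space K] [PathConnectedSpace K] {n : ℕ} [NeZero n]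
    {c : Fin n → K} (hc : Function.Injective c) {V : Set (Fin n → E)} :
    HasEquivariantSection ρ wedgeEnd V ↔ HasEquivariantSection ρ c V := by
  obtain ⟨r, hr⟩ := exists_continuousMap_apply_eq_wedgeEnd hc
  obtain ⟨r', hr'⟩ := exists_continuousMap_wedge_apply_wedgeEnd_eq c
  exact ⟨fun h => h.of_continuousMap r hr, fun h => h.of_continuousMap r' hr'⟩

end EquivariantSection

/-! ### Sections on orbit spaces -/

section OrbitSpace

variable {G E : Type*} [Group G] [TopologicalSpace E] {n : ℕ}

/-- The translate of a tuple `(ω, x₁, …, xₙ)` by a group element. -/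
def PathTuple.translate (ρ : G →* (E ≃ₜ E)) (g : G) (a : PathTuple n E) : PathTuple n E :=
  ⟨((ρ g : C(E, E)).comp a.1.1, fun j => ρ g (a.1.2 j)), fun j => congrArg (ρ g) (a.2 j)⟩

theorem PathTuple.continuous_translate (ρ : G →* (E ≃ₜ E)) (g : G) :
    Continuous (PathTuple.translate (n := n) ρ g) := by
  refine Continuous.subtype_mk (Continuous.prodMk ?_ ?_) _
  · exact (ContinuousMap.continuous_postcomp _).comp (continuous_fst.comp continuous_subtype_val)
  · exact continuous_pi fun j => (ρ g).continuous.comp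
      ((continuous_apply j).comp (continuous_snd.comp continuous_subtype_val))

theorem pathTupleMk_eq_iff (ρ : G →* (E ≃ₜ E)) (a b : PathTuple n E) :
    Quotient.mk (pathTupleSetoid n ρ) a = Quotient.mk (pathTupleSetoid n ρ) b ↔
      ∃ g, PathTuple.translate ρ g a = b :=
  Quotient.eq.trans <| exists_congr fun _ =>
    ⟨fun h => (Subtype.ext (Prod.ext (ContinuousMap.ext h.1) (funext h.2))).symm,
      by rintro rfl; exact ⟨fun _ => rfl, fun _ => rfl⟩⟩

theorem isOpenQuotientMap_pathTupleMk (n : ℕ) (ρ : G →* (E ≃ₜ E)) :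
    IsOpenQuotientMap (Quotient.mk (pathTupleSetoid n ρ)) :=
  isOpenQuotientMap_of_apply_eq_iff isQuotientMap_quotient_mk' (PathTuple.continuous_translate ρ)
    (pathTupleMk_eq_iff ρ)

/-- Covering space actions: every point has a neighbourhood that is disjoint from its translate
under each homeomorphism `ρ g ≠ 1`. The homomorphism `ρ` itself may have a kernel. -/
def IsCoveringAction (ρ : G →* (E ≃ₜ E)) : Prop :=
  ∀ e, ∃ N ∈ 𝓝 e, ∀ g, ∀ y ∈ N, ρ g y ∈ N → ρ g = 1

variable {ρ : G →* (E ≃ₜ E)}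

theorem IsCoveringAction.isEmbedding_pathTuple [NeZero n] (hρ : IsCoveringAction ρ) :
    IsEmbedding fun a : PathTuple n E => (a.1.2, Quotient.mk (pathTupleSetoid n ρ) a) := by
  have hmk := isOpenQuotientMap_pathTupleMk n ρ
  refine isEmbedding_prodMk_of_injOn_preimage (continuous_snd.comp continuous_subtype_val)
    hmk.continuous hmk.isOpenMap fun x => ?_
  obtain ⟨N, hN, hfree⟩ := hρ (x 0)
  refine ⟨(fun y => y 0) ⁻¹' N, (continuous_apply 0).continuousAt.preimage_mem_nhds hN, ?_⟩
  intro a ha b hb hab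
  obtain ⟨g, rfl⟩ := (pathTupleMk_eq_iff ρ a b).1 hab
  have hg : ρ g = 1 := hfree g (a.1.2 0) ha hb
  simp only [PathTuple.translate, hg]
  rfl

theorem exists_pathTupleMk_eq_of_evalMap_eq {x : Fin n → E} {q : Quotient (pathTupleSetoid n ρ)}
    (h : evalMap n ρ q = Quotient.mk (tupleSetoid n ρ) x) :
    ∃ a : PathTuple n E, a.1.2 = x ∧ Quotient.mk (pathTupleSetoid n ρ) a = q := by
  obtain ⟨a, rfl⟩ := Quotient.exists_rep q
  obtain ⟨g, hg⟩ : tupleSetoid n ρ a.1.2 x := Quotient.exact h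
  exact ⟨PathTuple.translate ρ g a, (funext hg).symm,
    ((pathTupleMk_eq_iff ρ _ _).2 ⟨g, rfl⟩).symm⟩

theorem IsCoveringAction.hasEquivariantSection_of_section [NeZero n] (hρ : IsCoveringAction ρ)
    {B : Set (Quotient (tupleSetoid n ρ))} (τ : C(B, Quotient (pathTupleSetoid n ρ)))
    (hτ : ∀ b, evalMap n ρ (τ b) = b) :
    HasEquivariantSection ρ (subdiv n) (Quotient.mk (tupleSetoid n ρ) ⁻¹' B) := by
  let cls := B.restrictPreimage (Quotient.mk (tupleSetoid n ρ))
  have hcls : Continuous cls := continuous_quotient_mk'.restrictPreimage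
  choose a hax ha using fun x => exists_pathTupleMk_eq_of_evalMap_eq (x := x.1) (hτ (cls x))
  have ha_cont : Continuous a := hρ.isEmbedding_pathTuple.continuous_iff.2 <| by
    simpa only [Function.comp_def, hax, ha] using
      continuous_subtype_val.prodMk (τ.continuous.comp hcls)
  have ha_equiv : ∀ (g : G) x y, (∀ j, y.1 j = ρ g (x.1 j)) →
      a y = PathTuple.translate ρ g (a x) := by
    intro g x y hxy
    have hclsxy : cls x = cls y := Subtype.ext (Quotient.sound ⟨g, hxy⟩)
    refine hρ.isEmbedding_pathTuple.injective (Prod.ext ?_ ?_)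
    · exact (hax y).trans (funext fun j => by rw [hxy j, ← hax x]; rfl)
    · exact ((ha y).trans (by rw [← hclsxy, ha x])).trans
        ((pathTupleMk_eq_iff ρ _ _).2 ⟨g, rfl⟩)
  refine ⟨⟨fun x => (a x).1.1, continuous_fst.comp (continuous_subtype_val.comp ha_cont)⟩, ?_, ?_⟩
  · exact fun x j => ((a x).2 j).trans (congrFun (hax x) j)
  · exact fun g x y hxy t => by
      simp only [ContinuousMap.coe_mk, ha_equiv g x y hxy]
      rfl

theorem HasEquivariantSection.exists_section {B : Set (Quotient (tupleSetoid n ρ))}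
    (hB : IsOpen B)
    (h : HasEquivariantSection ρ (subdiv n) (Quotient.mk (tupleSetoid n ρ) ⁻¹' B)) :
    ∃ τ : C(B, Quotient (pathTupleSetoid n ρ)), ∀ b, evalMap n ρ (τ b) = b := by
  obtain ⟨s, hs, heq⟩ := h
  let cls : C(Quotient.mk (tupleSetoid n ρ) ⁻¹' B, B) :=
    ⟨B.restrictPreimage _, continuous_quotient_mk'.restrictPreimage⟩
  have hcls : IsQuotientMap cls := isQuotientMap_quotient_mk'.restrictPreimage_isOpen hB
  let τ' : C(Quotient.mk (tupleSetoid n ρ) ⁻¹' B, Quotient (pathTupleSetoid n ρ)) :=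
    ⟨fun x => Quotient.mk _ ⟨(s x, x.1), hs x⟩, continuous_quotient_mk'.comp
      ((s.continuous.prodMk continuous_subtype_val).subtype_mk _)⟩
  have hτ' : Function.FactorsThrough τ' cls := by
    intro x y hxy
    obtain ⟨g, hg⟩ : tupleSetoid n ρ x.1 y.1 := Quotient.exact (congrArg Subtype.val hxy)
    exact Quotient.sound ⟨g, heq g x y hg, hg⟩
  refine ⟨hcls.lift τ' hτ', fun b => ?_⟩
  obtain ⟨x, rfl⟩ := hcls.surjective b
  exact congrArg (evalMap n ρ) (DFunLike.congr_fun (hcls.lift_comp τ' hτ') x)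

end OrbitSpace

theorem preimage_image_piMap_of_invariant {G E X ι : Type*} {T : G → E → E} {P : E → X}
    (hfib : ∀ e e', P e = P e' → ∃ g, T g e = e') {V : Set (ι → E)}
    (hV : ∀ g : ι → G, ∀ x ∈ V, (fun j => T (g j) (x j)) ∈ V) :
    Pi.map (fun _ => P) ⁻¹' (Pi.map (fun _ => P) '' V) = V := by
  refine Subset.antisymm ?_ (subset_preimage_image _ V)
  rintro x ⟨y, hy, hyx⟩
  choose g hg using fun j => hfib (y j) (x j) (congrFun hyx j)
  exact funext hg ▸ hV g y hy

section Comparison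

variable {G E X : Type*} [Group G] [TopologicalSpace E] [TopologicalSpace X] {ρ : G →* (E ≃ₜ E)}

theorem continuous_projMap (n : ℕ) {P : E → X} (hP : Continuous P)
    (h : ∀ g e, P (ρ g e) = P e) : Continuous (projMap n ρ P h) :=
  Continuous.quotient_lift (by fun_prop) _

theorem IsCoveringAction.exists_section_preimage_projMap_iff {n : ℕ} (hn : 2 ≤ n)
    (hρ : IsCoveringAction ρ) {P : E → X} (hP : Continuous P) (h : ∀ g e, P (ρ g e) = P e)
    {U : Set (Fin n → X)} (hU : IsOpen U) :
    (∃ τ : C(projMap n ρ P h ⁻¹' U, Quotient (pathTupleSetoid n ρ)),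
        ∀ b, evalMap n ρ (τ b) = b) ↔
      HasEquivariantSection ρ wedgeEnd (Pi.map (fun _ : Fin n => P) ⁻¹' U) := by
  have : NeZero n := ⟨by omega⟩
  have : PathConnectedSpace I := isPathConnected_iff_pathConnectedSpace.1
    ((convex_Icc (0 : ℝ) 1).isPathConnected (nonempty_Icc.2 zero_le_one))
  rw [hasEquivariantSection_wedgeEnd_iff (subdiv_injective hn)]
  exact ⟨fun ⟨τ, hτ⟩ => hρ.hasEquivariantSection_of_section τ hτ,
    fun hs => hs.exists_section (hU.preimage (continuous_projMap n hP h))⟩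

theorem theoremB_general {n : ℕ} (hn : 2 ≤ n) (hρ : IsCoveringAction ρ) {P : E → X}
    (hP : IsQuotientMap P) (hfib : ∀ e e', P e = P e' ↔ ∃ g, ρ g e = e') :
    secatTilde (evalMap n ρ) (projMap n ρ P fun g e => ((hfib e (ρ g e)).2 ⟨g, rfl⟩).symm) =
      strongTC n ρ := by
  have hPn : IsOpenQuotientMap (Pi.map fun _ : Fin n => P) := .piMap fun _ =>
    isOpenQuotientMap_of_apply_eq_iff hP (fun g => (ρ g).continuous) hfib
  refine congrArg leastCount (funext fun k => propext ⟨?_, ?_⟩)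
  · rintro ⟨U, hUo, hUc, hU⟩
    refine ⟨fun i => Pi.map (fun _ => P) ⁻¹' U i, fun i => (hUo i).preimage hPn.continuous, ?_,
      fun i g x hx => ?_,
      fun i => (hρ.exists_section_preimage_projMap_iff hn hP.continuous _ (hUo i)).1 (hU i)⟩
    · rw [← preimage_iUnion, hUc, preimage_univ]
    · have hgx : Pi.map (fun _ => P) (fun j => ρ (g j) (x j)) = Pi.map (fun _ => P) x :=
        funext fun j => ((hfib _ _).2 ⟨g j, rfl⟩).symm
      rwa [mem_preimage, hgx]
  · rintro ⟨V, hVo, hVc, hVinv, hV⟩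
    have hUo : ∀ i, IsOpen (Pi.map (fun _ => P) '' V i) := fun i => hPn.isOpenMap _ (hVo i)
    refine ⟨fun i => Pi.map (fun _ => P) '' V i, hUo, ?_, fun i => ?_⟩
    · rw [← image_iUnion, hVc, image_univ, hPn.surjective.range_eq]
    · rw [hρ.exists_section_preimage_projMap_iff hn hP.continuous _ (hUo i),
        preimage_image_piMap_of_invariant (fun e e' => (hfib e e').1) (hVinv i)]
      exact hV i

end Comparison

/-! ### The action of the fundamental group -/

section DeckAction

variable {X E : Type*} [TopologicalSpace X] [TopologicalSpace E] [PathConnectedSpace X]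
  [LocallyPathConnectedSpace X] [SimplyConnectedSpace E] {P : E → X}

theorem exists_deckAction_eq (hP : IsCoveringMap P) (e₀ : E) (φ : deckGroup P) :
    ∃ γ, deckAction hP e₀ γ = φ := by
  obtain ⟨γ, hγ⟩ := (MulEquiv.op (hP.isQuotientCoveringMap_deck.fundamentalGroupEquiv
    (⟨e₀, rfl⟩ : P ⁻¹' {P e₀}))).surjective (MulEquiv.opOp (deckGroup P) φ)
  exact ⟨γ, congrArg (fun ψ => ((MulEquiv.opOp (deckGroup P)).symm ψ).1) hγ⟩

theorem apply_eq_iff_exists_deckAction (hP : IsCoveringMap P) (e₀ e e' : E) :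
    P e = P e' ↔ ∃ γ, deckAction hP e₀ γ e = e' := by
  constructor
  · intro h
    obtain ⟨φ, hφ⟩ := hP.exists_deck h.symm
    obtain ⟨γ, hγ⟩ := exists_deckAction_eq hP e₀ φ
    exact ⟨γ, hγ ▸ hφ⟩
  · rintro ⟨γ, rfl⟩
    exact (apply_deckAction hP e₀ γ e).symm

theorem isCoveringAction_deckAction (hP : IsCoveringMap P) (e₀ : E) :
    IsCoveringAction (deckAction hP e₀) := by
  intro e
  obtain ⟨N, hN, hdisj⟩ := hP.isQuotientCoveringMap_deck.disjoint e
  refine ⟨N, hN, fun γ y hy hγy => ?_⟩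
  let φ : deckGroup P := ⟨deckAction hP e₀ γ, apply_deckAction hP e₀ γ⟩
  exact congrArg Subtype.val (hdisj φ ⟨_, ⟨y, hy, rfl⟩, hγy⟩)

end DeckAction

theorem theoremB {X : Type*} [TopologicalSpace X] [T2Space X] [PathConnectedSpace X]
    [CWComplex (univ : Set X)] (hX : IsLocallyFiniteCW X)
    {E : Type*} [TopologicalSpace E] [SimplyConnectedSpace E]
    (P : E → X) (hP : IsCoveringMap P) (e₀ : E) (n : ℕ) (hn : 2 ≤ n) :
    tildeTC n hP e₀ = strongTC n (deckAction hP e₀) :=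
  theoremB_general hn (isCoveringAction_deckAction hP e₀)
    hP.isQuotientCoveringMap_deck.toIsQuotientMap (apply_eq_iff_exists_deckAction hP e₀)
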